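/- Fix $n\in\mathbb N$, $T>0$ and $\alpha\in(0,1)$. For $t\in[0,T]$ let $AC^\alpha([0,t],\mathbb R^n)$ be the set of functions of the form $x(\tau)=x(0)+(I^\alpha\psi)(\tau)$, $\tau\in[0,t]$, with $\psi$ measurable and essentially bounded and $(I^\alpha\psi)(\tau)=\frac1{\Gamma(\alpha)}\int_0^\tau\frac{\psi(\xi)}{(\tau-\xi)^{1-\alpha}}\,d\xi$; for such $x$ let ${}^CD^\alpha x=\frac{d}{d\tau}I^{1-\alpha}(x(\cdot)-x(0))$ (which exists a.e.) be its Caputo derivative. Let $G^\alpha_n$ be the set of pairs $(t,w(\cdot))$ with $t\in[0,T]$, $w(\cdot)\in AC^\alpha([0,t],\mathbb R^n)$, metrized by the Hausdorff distance between the graphs of the paths in the Euclidean space $\mathbb R\times\mathbb R^n$, and let $G^{\alpha\circ}_n=\{(t,w(\cdot))\in G^\alpha_n: t<T\}$. For a function $x(\cdot)$ on $[0,T]$, $x_t(\cdot)$ denotes its restriction to $[0,t]$. A functional $\varphi:G^\alpha_n\to\mathbb R$ is $ci$-differentiable of order $\alpha$ at $(t_0,w_0(\cdot))\in G^{\alpha\circ}_n$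 with $ci$-derivatives $\partial_t^\alpha\varphi(t_0,w_0(\cdot))\in\mathbb R$ and $\nabla^\alpha\varphi(t_0,w_0(\cdot))\in\mathbb R^n$ if for every $x(\cdot)\in AC^\alpha([0,T],\mathbb R^n)$ with $x=w_0$ on $[0,t_0]$ one has, as $t\to t_0+0$, $$\varphi(t,x_t(\cdot))-\varphi(t_0,w_0(\cdot))=\partial_t^\alpha\varphi(t_0,w_0(\cdot))(t-t_0)+\int_{t_0}^t\langle\nabla^\alpha\varphi(t_0,w_0(\cdot)),({}^CD^\alpha x)(\tau)\rangle\,d\tau+o(t-t_0).$$ It is $ci$-smooth of order $\alpha$ if it is continuous, $ci$-differentiable of order $\alpha$ at every point of $G^{\alpha\circ}_n$, and $\partial^\alpha_t\varphi$, $\nabla^\alpha\varphi$ are continuous on $G^{\alpha\circ}_n$. Let $H:[0,T]\times\mathbb R^n\times\mathbb R^n\to\mathbb R$ be continuous, let $c_H>0$ be such that $|H(t,x,s)-H(t,x,s')|\le c_H(1+\|x\|)\|s-s'\|$ for all $t,x,s,s'$, and suppose that for every $R\ge0$ there is $\lambda_H>0$ with $|H(t,x,s)-H(t,x',s)|\le\lambda_H(1+\|s\|)\|x-x'\|$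 for all $t$, $s$ and all $x,x'$ with $\|x\|,\|x'\|\le R$. Let $\sigma:AC^\alpha([0,T],\mathbb R^n)\to\mathbb R$ be continuous in the uniform norm. Consider the Cauchy problem $$\partial^\alpha_t\varphi(t,w(\cdot))+H\big(t,w(t),\nabla^\alpha\varphi(t,w(\cdot))\big)=0,\quad (t,w(\cdot))\in G^{\alpha\circ}_n,\qquad \varphi(T,w(\cdot))=\sigma(w(\cdot)),\quad w(\cdot)\in AC^\alpha([0,T],\mathbb R^n).$$ A classical solution is a functional that is $ci$-smooth of order $\alpha$ and satisfies both relations. For $(t_0,w_0(\cdot))\in G^\alpha_n$ and $s\in\mathbb R^n$ let $CH(t_0,w_0(\cdot),0,s)$ be the set of pairs of $x(\cdot)\in AC^\alpha([0,T],\mathbb R^n)$ and Lipschitz $z:[0,T]\to\mathbb R$ with $x=w_0$, $z=0$ on $[0,t_0]$ and, for a.e. $t\in[t_0,T]$, $\|({}^CD^\alpha x)(t)\|\le c_H(1+\|x(t)\|)$ and $\dot z(t)=\langle s,({}^CD^\alpha x)(t)\rangle-H(t,x(t),s)$. An upper (lower) solution is a lower (upper) semicontinuous $\varphi:G^\alpha_n\to\mathbb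 R$ with $\varphi(T,w(\cdot))\ge\sigma(w(\cdot))$ (respectively $\le$) for all $w(\cdot)\in AC^\alpha([0,T],\mathbb R^n)$ such that for all $(t_0,w_0(\cdot))\in G^{\alpha\circ}_n$, $t\in(t_0,T]$, $s\in\mathbb R^n$ and $\varepsilon>0$ there is $(x(\cdot),z(\cdot))\in CH(t_0,w_0(\cdot),0,s)$ with $\varphi(t,x_t(\cdot))-z(t)\le\varphi(t_0,w_0(\cdot))+\varepsilon$ (respectively $\ge\varphi(t_0,w_0(\cdot))-\varepsilon$). A minimax solution is a functional that is both an upper and a lower solution. Then every minimax solution of the Cauchy problem that is $ci$-smooth of order $\alpha$ is a classical solution of this problem. -/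

import Mathlib

open MeasureTheory Set Filter Topology Asymptotics
open scoped ENNReal

namespace FracHJ

/-- The Euclidean space `ℝⁿ`. -/
abbrev Vec (n : ℕ) : Type := EuclideanSpace ℝ (Fin n)

/-- Extension of a function on `[0, t]` to `ℝ` by zero. It only serves to evaluate functions
at real arguments; values outside `[0, t]` never matter below. -/
noncomputable def zeroExt {n : ℕ} {t : ℝ} (w : Icc (0 : ℝ) t → Vec n) (τ : ℝ) : Vec n :=
  open Classical in if h : τ ∈ Icc (0 : ℝ) t then w ⟨τ, h⟩ else 0

/-- The left-sided Riemann--Liouville integral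
`(I^α ψ)(τ) = (1 / Γ(α)) ∫₀^τ ψ(ξ) / (τ - ξ)^(1 - α) dξ`, with `I^0 ψ = ψ`. -/
noncomputable def rlIntegral {n : ℕ} (α : ℝ) (ψ : ℝ → Vec n) (τ : ℝ) : Vec n :=
  if α = 0 then ψ τ
  else (Real.Gamma α)⁻¹ • ∫ ξ in (0 : ℝ)..τ, ((τ - ξ) ^ (1 - α))⁻¹ • ψ ξ

/-- The left-sided Caputo derivative `(ᶜD^α x)(τ) = d/dτ (I^(1-α) (x(·) - x(0)))(τ)`. -/
noncomputable def caputoDeriv {n : ℕ} (α : ℝ) (x : ℝ → Vec n) (τ : ℝ) : Vec n :=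
  deriv (rlIntegral (1 - α) (fun ξ => x ξ - x 0)) τ

/-- `x(·) ∈ AC^α([0, t], ℝⁿ)`: one has `x(τ) = x(0) + (I^α ψ)(τ)` on `[0, t]` for some
measurable and essentially bounded `ψ`. -/
def IsAC {n : ℕ} (α : ℝ) {t : ℝ} (x : C(Icc (0 : ℝ) t, Vec n)) : Prop :=
  ∃ ψ : ℝ → Vec n, MemLp ψ ∞ (volume.restrict (Icc (0 : ℝ) t)) ∧
    ∀ τ : Icc (0 : ℝ) t, x τ = zeroExt x 0 + rlIntegral α ψ τ

/-- The set `AC^α([0, t], ℝⁿ)`, a subset of `C([0, t], ℝⁿ)` with the uniform norm. -/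
abbrev ACFun (α : ℝ) (n : ℕ) (t : ℝ) : Type :=
  {x : C(Icc (0 : ℝ) t, Vec n) // IsAC α x}

/-- The set `G_n` of pairs `(t, w(·))` with `t ∈ [0, T]` and `w(·) ∈ C([0, t], ℝⁿ)`. -/
structure PathPt (n : ℕ) (T : ℝ) where
  /-- the time `t` -/
  t : Icc (0 : ℝ) T
  /-- the path `w(·)` -/
  w : C(Icc (0 : ℝ) (t : ℝ), Vec n)

namespace PathPt

/-- The final value `w(t)` of `(t, w(·))`. -/
def endpoint {n : ℕ} {T : ℝ} (p : PathPt n T) : Vec n :=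
  p.w ⟨p.t, p.t.2.1, le_rfl⟩

/-- The graph of `w(·)`, a nonempty compact subset of `ℝ × ℝⁿ`, where `ℝ × ℝⁿ` carries the
Euclidean metric `√(|τ - τ'|² + ‖x - x'‖²)`. -/
def graph {n : ℕ} {T : ℝ} (p : PathPt n T) :
    TopologicalSpace.NonemptyCompacts (WithLp 2 (ℝ × Vec n)) where
  carrier := range fun τ : Icc (0 : ℝ) (p.t : ℝ) => WithLp.toLp 2 ((τ : ℝ), p.w τ)
  isCompact' := isCompact_range (by fun_prop)
  nonempty' := ⟨_, ⟨⟨0, le_rfl, p.t.2.1⟩, rfl⟩⟩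

theorem graph_injective {n : ℕ} {T : ℝ} :
    Function.Injective (graph : PathPt n T → _) := by
  have key : ∀ p q : PathPt n T, graph p = graph q →
      ∀ τ (h : τ ∈ Icc (0 : ℝ) (p.t : ℝ)), ∃ h' : τ ∈ Icc (0 : ℝ) (q.t : ℝ),
        q.w ⟨τ, h'⟩ = p.w ⟨τ, h⟩ := by
    intro p q hpq τ h
    have hm : WithLp.toLp 2 (τ, p.w ⟨τ, h⟩) ∈ graph q := by
      rw [← hpq]
      exact ⟨⟨τ, h⟩, rfl⟩
    obtain ⟨⟨τ', h'⟩, he⟩ := hm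
    have h1 := congrArg (fun v => (WithLp.ofLp v).1) he
    have h2 := congrArg (fun v => (WithLp.ofLp v).2) he
    simp only at h1 h2
    subst h1
    exact ⟨h', h2⟩
  intro p q hpq
  have ht : p.t = q.t := by
    apply Subtype.ext
    apply le_antisymm
    · exact (key p q hpq _ ⟨p.t.2.1, le_rfl⟩).1.2
    · exact (key q p hpq.symm _ ⟨q.t.2.1, le_rfl⟩).1.2
  obtain ⟨t, w⟩ := p
  obtain ⟨t', w'⟩ := q
  simp only at ht
  subst ht
  congr 1
  ext1 τ
  exact (key _ _ hpq τ.1 τ.2).2.symm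

/-- The metric `dist` on `G_n`: the Hausdorff distance between graphs, that is
`max {dist*(p, q), dist*(q, p)}` with
`dist*(p, q) = max_τ min_τ' √(|τ - τ'|² + ‖w(τ) - w'(τ')‖²)`. -/
noncomputable instance {n : ℕ} {T : ℝ} : MetricSpace (PathPt n T) :=
  MetricSpace.induced graph graph_injective inferInstance

end PathPt

/-- The set `G_n^α` of the points `(t, w(·))` of `G_n` with `w(·) ∈ AC^α([0, t], ℝⁿ)`. -/
abbrev GA (α : ℝ) (n : ℕ) (T : ℝ) : Type := {p : PathPt n T // IsAC α p.w}

/-- The set `G_n^{α∘}` of the points `(t, w(·))` of `G_n^α` with `t < T`. -/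
abbrev GAo (α : ℝ) (n : ℕ) (T : ℝ) : Type := {p : GA α n T // (p.1.t : ℝ) < T}

/-- The point `(t, x_t(·))`, where `x_t(·)` is the restriction of `x(·)` to `[0, t]`. -/
def restr {α : ℝ} {n : ℕ} {T : ℝ} (x : ACFun α n T) (t : Icc (0 : ℝ) T) : GA α n T :=
  ⟨⟨t, x.1.comp ⟨inclusion (Icc_subset_Icc_right t.2.2), continuous_inclusion _⟩⟩, by
    obtain ⟨ψ, hψ, hx⟩ := x.2
    refine ⟨ψ, hψ.mono_measure (Measure.restrict_mono (Icc_subset_Icc_right t.2.2) le_rfl), ?_⟩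
    intro τ
    have h0 : (0 : ℝ) ∈ Icc (0 : ℝ) (t : ℝ) := ⟨le_rfl, t.2.1⟩
    have h0' : (0 : ℝ) ∈ Icc (0 : ℝ) T := ⟨le_rfl, t.2.1.trans t.2.2⟩
    have := hx (inclusion (Icc_subset_Icc_right t.2.2) τ)
    simp only [zeroExt, h0', dite_true] at this
    simp only [zeroExt, h0, dite_true]
    exact this⟩

/-- The point `(T, w(·))` for `w(·) ∈ AC^α([0, T], ℝⁿ)`. -/
def terminal {α : ℝ} {n : ℕ} {T : ℝ} (hT : 0 < T) (w : ACFun α n T) : GA α n T :=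
  ⟨⟨⟨T, hT.le, le_rfl⟩, w.1⟩, w.2⟩

/-- `x(·) ∈ X^α(t₀, w₀(·))`: `x(·) ∈ AC^α([0, T], ℝⁿ)` coincides with `w₀(·)` on `[0, t₀]`. -/
def Extends {α : ℝ} {n : ℕ} {T : ℝ} (x : ACFun α n T) (p : PathPt n T) : Prop :=
  ∀ τ ∈ Icc (0 : ℝ) (p.t : ℝ), zeroExt x.1 τ = zeroExt p.w τ

/-- `φ` is `ci`-differentiable of order `α` at `p = (t₀, w₀(·))` with `ci`-derivatives
`a = ∂_t^α φ(p)` and `g = ∇^α φ(p)`. -/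
def HasCiDerivAt {α : ℝ} {n : ℕ} {T : ℝ} (φ : GA α n T → ℝ) (p : GAo α n T)
    (a : ℝ) (g : Vec n) : Prop :=
  ∀ x : ACFun α n T, Extends x p.1.1 →
    (fun t : Icc (0 : ℝ) T =>
      φ (restr x t) - φ p.1 - a * ((t : ℝ) - p.1.1.t)
        - ∫ τ in (p.1.1.t : ℝ)..t, inner ℝ g (caputoDeriv α (zeroExt x.1) τ))
      =o[𝓝[>] p.1.1.t] fun t : Icc (0 : ℝ) T => (t : ℝ) - p.1.1.t

/-- `φ` is `ci`-smooth of order `α`: it is continuous, `ci`-differentiable of order `α` at every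
point of `G_n^{α∘}`, and its `ci`-derivatives are continuous on `G_n^{α∘}`. -/
def IsCiSmooth {α : ℝ} {n : ℕ} {T : ℝ} (φ : GA α n T → ℝ) : Prop :=
  Continuous φ ∧ ∃ (a : GAo α n T → ℝ) (g : GAo α n T → Vec n),
    (∀ p, HasCiDerivAt φ p (a p) (g p)) ∧ Continuous a ∧ Continuous g

/-- `φ` satisfies the Hamilton--Jacobi equation
`∂_t^α φ(t, w(·)) + H(t, w(t), ∇^α φ(t, w(·))) = 0` at the point `p = (t, w(·))`: it is
`ci`-differentiable there, and its `ci`-derivatives satisfy the equation. -/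
def SatisfiesHJAt {α : ℝ} {n : ℕ} {T : ℝ} (H : ℝ → Vec n → Vec n → ℝ) (φ : GA α n T → ℝ)
    (p : GAo α n T) : Prop :=
  (∃ a g, HasCiDerivAt φ p a g) ∧
    ∀ a g, HasCiDerivAt φ p a g → a + H p.1.1.t p.1.1.endpoint g = 0

/-- Classical solutions of the Cauchy problem. -/
def IsClassicalSolution {α : ℝ} {n : ℕ} {T : ℝ} (hT : 0 < T) (H : ℝ → Vec n → Vec n → ℝ)
    (σ : ACFun α n T → ℝ) (φ : GA α n T → ℝ) : Prop :=
  IsCiSmooth φ ∧ (∀ p : GAo α n T, SatisfiesHJAt H φ p) ∧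
    ∀ w : ACFun α n T, φ (terminal hT w) = σ w

/-- The set `E(t, x, s)` of all `(f, h) ∈ ℝⁿ × ℝ` with `‖f‖ ≤ c_H (1 + ‖x‖)` and
`h = ⟨s, f⟩ - H(t, x, s)`. -/
def charSet {n : ℕ} (cH : ℝ) (H : ℝ → Vec n → Vec n → ℝ) (t : ℝ) (x s : Vec n) :
    Set (Vec n × ℝ) :=
  {q | ‖q.1‖ ≤ cH * (1 + ‖x‖) ∧ q.2 = inner ℝ s q.1 - H t x s}

/-- `(x(·), z(·)) ∈ CH(t₀, w₀(·), z₀, s)`: `x(·) ∈ AC^α([0, T], ℝⁿ)` and `z(·) ∈ Lip([0, T], ℝ)`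
satisfy `x(t) = w₀(t)`, `z(t) = z₀` on `[0, t₀]` and
`((ᶜD^α x)(t), ż(t)) ∈ E(t, x(t), s)` for a.e. `t ∈ [t₀, T]`. Only the values of `z` on `[0, T]`
matter; both derivatives exist almost everywhere for such functions. -/
def IsCharacteristic {α : ℝ} {n : ℕ} {T : ℝ} (cH : ℝ) (H : ℝ → Vec n → Vec n → ℝ)
    (p : PathPt n T) (z₀ : ℝ) (s : Vec n) (x : ACFun α n T) (z : ℝ → ℝ) : Prop :=
  Extends x p ∧ (∃ K, LipschitzOnWith K z (Icc 0 T)) ∧ (∀ t ∈ Icc (0 : ℝ) (p.t : ℝ), z t = z₀) ∧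
    ∀ᵐ t ∂(volume.restrict (Icc (p.t : ℝ) T)),
      (caputoDeriv α (zeroExt x.1) t, deriv z t) ∈ charSet cH H t (zeroExt x.1 t) s

/-- Upper solutions of the Cauchy problem. -/
def IsUpperSolution {α : ℝ} {n : ℕ} {T : ℝ} (hT : 0 < T) (cH : ℝ) (H : ℝ → Vec n → Vec n → ℝ)
    (σ : ACFun α n T → ℝ) (φ : GA α n T → ℝ) : Prop :=
  LowerSemicontinuous φ ∧ (∀ w : ACFun α n T, σ w ≤ φ (terminal hT w)) ∧
    ∀ (p : GAo α n T) (t : Icc (0 : ℝ) T), p.1.1.t < t → ∀ (s : Vec n) (ε : ℝ), 0 < ε →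
      ∃ (x : ACFun α n T) (z : ℝ → ℝ), IsCharacteristic cH H p.1.1 0 s x z ∧
        φ (restr x t) - z t ≤ φ p.1 + ε

/-- Lower solutions of the Cauchy problem. -/
def IsLowerSolution {α : ℝ} {n : ℕ} {T : ℝ} (hT : 0 < T) (cH : ℝ) (H : ℝ → Vec n → Vec n → ℝ)
    (σ : ACFun α n T → ℝ) (φ : GA α n T → ℝ) : Prop :=
  UpperSemicontinuous φ ∧ (∀ w : ACFun α n T, φ (terminal hT w) ≤ σ w) ∧
    ∀ (p : GAo α n T) (t : Icc (0 : ℝ) T), p.1.1.t < t → ∀ (s : Vec n) (ε : ℝ), 0 < ε →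
      ∃ (x : ACFun α n T) (z : ℝ → ℝ), IsCharacteristic cH H p.1.1 0 s x z ∧
        φ p.1 - ε ≤ φ (restr x t) - z t

/-- Minimax solutions of the Cauchy problem. -/
def IsMinimaxSolution {α : ℝ} {n : ℕ} {T : ℝ} (hT : 0 < T) (cH : ℝ)
    (H : ℝ → Vec n → Vec n → ℝ) (σ : ACFun α n T → ℝ) (φ : GA α n T → ℝ) : Prop :=
  IsUpperSolution hT cH H σ φ ∧ IsLowerSolution hT cH H σ φ

end FracHJ

/-! The terminal condition follows from the two boundary inequalities. For the equation, fix a point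
`p` with `ci`-derivatives `a p`, `g p` and take the characteristics with `s = g p`. Along such a
pair `(x, z)` the rate of change of `φ - z` at time `r` is `a + ⟨g, ᶜD^α x⟩ - ⟨s, ᶜD^α x⟩ + H(r,
x(r), s)`, with `a`, `g` taken at `(r, x_r)`. Near `p` the inner products almost cancel, so the rate
is close to `Q = ∂_t^α φ(p) + H(p, ∇^α φ(p))`. The upper property then forces `Q ≤ 0`, the lower one
`Q ≥ 0`.

The difficulty is uniformity: the characteristic supplied by the definition varies with `t` and `ε`,
whereas the remainder in `ci`-differentiability belongs to one fixed `x`. Two facts overcome it: an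
integral formula for `φ` along a path (`sub_eq_integral_of_hasCiDerivAt`), where continuity of `a`
and `g` replaces the remainder, and equicontinuity of all characteristics at the time of `p`
(`exists_forall_norm_sub_le`). They combine in `exists_forall_characteristic_le`. Uniqueness of
`ci`-derivatives transfers the equation to any admissible pair. -/

namespace FracHJ

/-! ### Integrals of the fractional kernels. -/

section Kernel

variable {α : ℝ}

theorem inv_rpow_one_sub {u : ℝ} (hu : 0 ≤ u) : (u ^ (1 - α))⁻¹ = u ^ (α - 1) := by
  rw [← Real.rpow_neg hu, neg_sub]

theorem intervalIntegrable_kernel (hα : 0 < α) {a b τ : ℝ} (hab : a ≤ b) (hb : b ≤ τ) :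
    IntervalIntegrable (fun ξ => ((τ - ξ) ^ (1 - α))⁻¹) volume a b := by
  have h := (intervalIntegral.intervalIntegrable_rpow' (a := τ - a) (b := τ - b)
    (r := α - 1) (by linarith)).comp_sub_left τ
  simp only [sub_sub_cancel] at h
  refine h.congr ?_
  intro ξ hξ
  rw [uIoc_of_le hab] at hξ
  exact (inv_rpow_one_sub (by linarith [hξ.2])).symm

theorem integral_kernel (hα : 0 < α) {a b τ : ℝ} (hab : a ≤ b) (hb : b ≤ τ) :
    ∫ ξ in a..b, ((τ - ξ) ^ (1 - α))⁻¹ = ((τ - a) ^ α - (τ - b) ^ α) / α := by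
  have h : ∫ ξ in a..b, ((τ - ξ) ^ (1 - α))⁻¹ = ∫ ξ in a..b, (τ - ξ) ^ (α - 1) := by
    refine intervalIntegral.integral_congr fun ξ hξ => ?_
    rw [uIcc_of_le hab] at hξ
    exact inv_rpow_one_sub (by linarith [hξ.2])
  rw [h, intervalIntegral.integral_comp_sub_left (fun u => u ^ (α - 1)) τ,
    integral_rpow (Or.inl (by linarith)), sub_add_cancel]

/-- Shifting by `η` gives a scaled Beta integral `B(α, 1 - α)`. The two parameters sum to `1`, so
the interval length enters with exponent `0` and `Γ(1) = 1` is the denominator. -/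
theorem integral_kernel_mul_kernel (hα : α ∈ Ioo (0 : ℝ) 1) {η τ : ℝ} (h : η < τ) :
    ∫ ξ in η..τ, ((τ - ξ) ^ α)⁻¹ * ((ξ - η) ^ (1 - α))⁻¹ =
      Real.Gamma α * Real.Gamma (1 - α) := by
  have h1 : ∫ ξ in η..τ, ((τ - ξ) ^ α)⁻¹ * ((ξ - η) ^ (1 - α))⁻¹ =
      ∫ u in (0 : ℝ)..(τ - η), (((τ - η) - u) ^ α)⁻¹ * (u ^ (1 - α))⁻¹ := by
    have := intervalIntegral.integral_comp_sub_right (a := η) (b := τ)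
      (fun u => (((τ - η) - u) ^ α)⁻¹ * (u ^ (1 - α))⁻¹) η
    simpa using this
  have ha : 0 < τ - η := by linarith
  have h2 := Complex.betaIntegral_scaled α ((1 - α : ℝ) : ℂ) ha
  have h3 : ∫ u in (0 : ℝ)..(τ - η),
      (u : ℂ) ^ ((α : ℂ) - 1) * (((τ - η : ℝ) : ℂ) - u) ^ (((1 - α : ℝ) : ℂ) - 1) =
      ((∫ u in (0 : ℝ)..(τ - η), (((τ - η) - u) ^ α)⁻¹ * (u ^ (1 - α))⁻¹ : ℝ) : ℂ) := by
    rw [← intervalIntegral.integral_ofReal]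
    refine intervalIntegral.integral_congr fun u hu => ?_
    rw [uIcc_of_le ha.le] at hu
    have hu' : 0 ≤ τ - η - u := by linarith [hu.2]
    rw [inv_rpow_one_sub hu.1, ← Real.rpow_neg hu', mul_comm, Complex.ofReal_mul,
      Complex.ofReal_cpow hu', Complex.ofReal_cpow hu.1]
    push_cast
    ring_nf
  have h4 := Complex.Gamma_mul_Gamma_eq_betaIntegral (s := (α : ℂ)) (t := ((1 - α : ℝ) : ℂ))
    (by simpa using hα.1) (by simpa using hα.2)
  have h5 : (α : ℂ) + ((1 - α : ℝ) : ℂ) = 1 := by push_cast; ring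
  rw [h5, Complex.Gamma_one, one_mul] at h4
  rw [h3, h5, sub_self, Complex.cpow_zero, one_mul, ← h4, Complex.Gamma_ofReal,
    Complex.Gamma_ofReal] at h2
  rw [h1]
  exact_mod_cast h2

/-- A non-integrable function has integral `0` by convention, but the value just computed is
positive. -/
theorem intervalIntegrable_kernel_mul_kernel (hα : α ∈ Ioo (0 : ℝ) 1) {η τ : ℝ} (h : η < τ) :
    IntervalIntegrable (fun ξ => ((τ - ξ) ^ α)⁻¹ * ((ξ - η) ^ (1 - α))⁻¹) volume η τ := by
  by_contra hn
  have h1 := integral_kernel_mul_kernel hα h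
  rw [intervalIntegral.integral_undef hn] at h1
  exact (mul_pos (Real.Gamma_pos_of_pos hα.1) (Real.Gamma_pos_of_pos (sub_pos.2 hα.2))).ne h1

end Kernel

/-! ### Hölder continuity of the Riemann–Liouville integral. -/

section RL

variable {n : ℕ} {α : ℝ} {ψ : ℝ → Vec n} {M : ℝ}

theorem intervalIntegrable_of_bounded (hψ : StronglyMeasurable ψ) (hM : ∀ ξ, ‖ψ ξ‖ ≤ M)
    (a b : ℝ) : IntervalIntegrable ψ volume a b :=
  (intervalIntegrable_const (c := M)).mono_fun' hψ.aestronglyMeasurable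
    (Eventually.of_forall hM)

theorem intervalIntegrable_kernel_smul (hα : 0 < α) (hψ : StronglyMeasurable ψ)
    (hM : ∀ ξ, ‖ψ ξ‖ ≤ M) {a b τ : ℝ} (hab : a ≤ b) (hb : b ≤ τ) :
    IntervalIntegrable (fun ξ => ((τ - ξ) ^ (1 - α))⁻¹ • ψ ξ) volume a b := by
  have h := intervalIntegrable_kernel hα hab hb
  rw [intervalIntegrable_iff] at h ⊢
  exact h.smul_bdd M hψ.aestronglyMeasurable (Eventually.of_forall hM)

/-- On `[0, a]` the kernel difference has constant sign and total mass at most `(b - a)^α / α`,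
because `a^α ≤ b^α`; on `[a, b]` the kernel has exactly that mass. Past and future carry separate
bounds since for characteristics the past is known and the future is to be estimated. -/
theorem norm_rlIntegral_sub_le (hα : α ∈ Ioo (0 : ℝ) 1) (hψ : StronglyMeasurable ψ)
    (hM : ∀ ξ, ‖ψ ξ‖ ≤ M) {a b M₀ M₁ : ℝ} (ha : 0 ≤ a) (hab : a ≤ b) (hM₀ : 0 ≤ M₀)
    (h0 : ∀ᵐ ξ, ξ ∈ Ioc 0 a → ‖ψ ξ‖ ≤ M₀) (h1 : ∀ᵐ ξ, ξ ∈ Ioc a b → ‖ψ ξ‖ ≤ M₁) :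
    ‖rlIntegral α ψ b - rlIntegral α ψ a‖ ≤
      (Real.Gamma α)⁻¹ * ((M₀ + M₁) * ((b - a) ^ α / α)) := by
  have hα0 := hα.1
  have hk {c d τ : ℝ} (hcd : c ≤ d) (hd : d ≤ τ) := intervalIntegrable_kernel hα0 hcd hd
  have hkψ {c d τ : ℝ} (hcd : c ≤ d) (hd : d ≤ τ) :=
    intervalIntegrable_kernel_smul hα0 hψ hM hcd hd
  have hdec : rlIntegral α ψ b - rlIntegral α ψ a = (Real.Gamma α)⁻¹ •
      ((∫ ξ in (0 : ℝ)..a, (((b - ξ) ^ (1 - α))⁻¹ - ((a - ξ) ^ (1 - α))⁻¹) • ψ ξ) +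
        ∫ ξ in a..b, ((b - ξ) ^ (1 - α))⁻¹ • ψ ξ) := by
    simp only [rlIntegral, hα0.ne', if_false, sub_smul]
    rw [← smul_sub, intervalIntegral.integral_sub (hkψ ha hab) (hkψ ha le_rfl),
      ← intervalIntegral.integral_add_adjacent_intervals (hkψ ha hab) (hkψ hab le_rfl)]
    congr 1
    abel
  have hΓ : 0 < Real.Gamma α := Real.Gamma_pos_of_pos hα0
  rw [hdec, norm_smul, Real.norm_of_nonneg (inv_nonneg.2 hΓ.le)]
  refine mul_le_mul_of_nonneg_left ?_ (inv_nonneg.2 hΓ.le)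
  have hA : ‖∫ ξ in (0 : ℝ)..a, (((b - ξ) ^ (1 - α))⁻¹ - ((a - ξ) ^ (1 - α))⁻¹) • ψ ξ‖ ≤
      M₀ * ((b - a) ^ α / α) := by
    refine (intervalIntegral.norm_integral_le_of_norm_le (g := fun ξ =>
      (((a - ξ) ^ (1 - α))⁻¹ - ((b - ξ) ^ (1 - α))⁻¹) * M₀) ha ?_
      (((hk ha le_rfl).sub (hk ha hab)).mul_const _)).trans ?_
    · have hne : ∀ᵐ ξ : ℝ, ξ ≠ a := by simp [ae_iff, measure_singleton]
      filter_upwards [h0, hne] with ξ hξ hξa hmem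
      have hlt : ξ < a := lt_of_le_of_ne hmem.2 hξa
      have : ((b - ξ) ^ (1 - α))⁻¹ ≤ ((a - ξ) ^ (1 - α))⁻¹ := by
        have h1 : 0 < a - ξ := by linarith
        have h2 := hα.2
        gcongr
      rw [norm_smul, Real.norm_eq_abs, abs_sub_comm, abs_of_nonneg (by linarith)]
      exact mul_le_mul_of_nonneg_left (hξ hmem) (by linarith)
    · rw [intervalIntegral.integral_mul_const,
        intervalIntegral.integral_sub (hk ha le_rfl) (hk ha hab),
        integral_kernel hα0 ha le_rfl, integral_kernel hα0 ha hab, mul_comm]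
      refine mul_le_mul_of_nonneg_left ?_ hM₀
      rw [← sub_div]
      have h1 : a ^ α ≤ b ^ α := by gcongr
      have h2 : (0 : ℝ) ^ α = 0 := Real.zero_rpow hα0.ne'
      gcongr
      simp only [sub_zero, sub_self, h2]
      linarith
  have hB : ‖∫ ξ in a..b, ((b - ξ) ^ (1 - α))⁻¹ • ψ ξ‖ ≤ M₁ * ((b - a) ^ α / α) := by
    refine (intervalIntegral.norm_integral_le_of_norm_le (g := fun ξ =>
      ((b - ξ) ^ (1 - α))⁻¹ * M₁) hab ?_ ((hk hab le_rfl).mul_const _)).trans ?_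
    · filter_upwards [h1] with ξ hξ hmem
      have : 0 ≤ ((b - ξ) ^ (1 - α))⁻¹ :=
        inv_nonneg.2 (Real.rpow_nonneg (by linarith [hmem.2]) _)
      rw [norm_smul, Real.norm_of_nonneg this]
      exact mul_le_mul_of_nonneg_left (hξ hmem) this
    · rw [intervalIntegral.integral_mul_const, integral_kernel hα0 hab le_rfl, sub_self,
        Real.zero_rpow hα0.ne', sub_zero, mul_comm]
  calc _ ≤ _ := norm_add_le _ _
    _ ≤ _ := add_le_add hA hB
    _ = _ := by ring

theorem continuousOn_rlIntegral (hα : α ∈ Ioo (0 : ℝ) 1) (hψ : StronglyMeasurable ψ)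
    (hM : ∀ ξ, ‖ψ ξ‖ ≤ M) : ContinuousOn (rlIntegral α ψ) (Ici 0) := by
  have hM0 : 0 ≤ M := (norm_nonneg _).trans (hM 0)
  have key : ∀ a b : ℝ, 0 ≤ a → a ≤ b → dist (rlIntegral α ψ b) (rlIntegral α ψ a) ≤
      (Real.Gamma α)⁻¹ * ((M + M) * (|b - a| ^ α / α)) := fun a b ha hab => by
    rw [dist_eq_norm, abs_of_nonneg (sub_nonneg.2 hab)]
    exact norm_rlIntegral_sub_le hα hψ hM ha hab hM0 (.of_forall fun _ _ => hM _)
      (.of_forall fun _ _ => hM _)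
  intro a ha
  rw [ContinuousWithinAt, tendsto_iff_dist_tendsto_zero]
  have hlim : Tendsto (fun b : ℝ => (Real.Gamma α)⁻¹ * ((M + M) * (|b - a| ^ α / α)))
      (𝓝[Ici 0] a) (𝓝 0) := by
    have : Continuous fun b : ℝ => (Real.Gamma α)⁻¹ * ((M + M) * (|b - a| ^ α / α)) := by
      have := (continuous_id.sub (continuous_const (y := a))).abs.rpow_const
        (fun _ => Or.inr hα.1.le)
      fun_prop
    have h := this.tendsto a
    simp only [sub_self, abs_zero, Real.zero_rpow hα.1.ne', zero_div, mul_zero] at h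
    exact h.mono_left nhdsWithin_le_nhds
  refine squeeze_zero' (.of_forall fun _ => dist_nonneg) ?_ hlim
  filter_upwards [self_mem_nhdsWithin] with b hb
  rcases le_total a b with h | h
  · exact key a b ha h
  · rw [dist_comm, abs_sub_comm]
    exact key b a hb h

theorem rlIntegral_zero : α ≠ 0 → rlIntegral α ψ 0 = 0 := fun h => by
  simp [rlIntegral, h]

theorem rlIntegral_congr (hα : α ≠ 0) {ψ' : ℝ → Vec n} {τ : ℝ} (hτ : 0 ≤ τ)
    (h : ∀ᵐ ξ, ξ ∈ Ioc 0 τ → ψ ξ = ψ' ξ) : rlIntegral α ψ τ = rlIntegral α ψ' τ := by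
  simp only [rlIntegral, hα, if_false]
  congr 1
  refine intervalIntegral.integral_congr_ae ?_
  filter_upwards [h] with ξ hξ hmem
  rw [uIoc_of_le hτ] at hmem
  rw [hξ hmem]

end RL

/-! ### The Caputo derivative as a left inverse of `I^α`. -/

section Caputo

variable {n : ℕ} {α : ℝ} {ψ : ℝ → Vec n} {M : ℝ}

/-- Fubini on the triangle `η < ξ`: integrating in `ξ` first leaves the product of kernels, whose
integral does not depend on `η` and cancels the Gamma factors. -/
theorem rlIntegral_rlIntegral (hα : α ∈ Ioo (0 : ℝ) 1) (hψ : StronglyMeasurable ψ)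
    (hM : ∀ ξ, ‖ψ ξ‖ ≤ M) {τ : ℝ} (hτ : 0 ≤ τ) :
    rlIntegral (1 - α) (rlIntegral α ψ) τ = ∫ ξ in (0 : ℝ)..τ, ψ ξ := by
  have hα0 := hα.1
  have hα1 : 1 - α ≠ 0 := (sub_pos.2 hα.2).ne'
  set k : ℝ × ℝ → ℝ := fun p => ((τ - p.1) ^ α)⁻¹ * ((p.1 - p.2) ^ (1 - α))⁻¹ with hk
  set S : Set (ℝ × ℝ) := {p | p.2 < p.1} with hS
  have hSm : MeasurableSet S := measurableSet_lt measurable_snd measurable_fst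
  set f : ℝ × ℝ → Vec n := S.indicator fun p => k p • ψ p.2 with hf
  set μ : Measure ℝ := volume.restrict (Ioc 0 τ) with hμ
  have hfm : StronglyMeasurable f := by
    refine StronglyMeasurable.indicator ?_ hSm
    have hkm : StronglyMeasurable k := Measurable.stronglyMeasurable (by fun_prop)
    exact hkm.smul (hψ.comp_measurable measurable_snd)
  have hfη : ∀ η : ℝ, (fun ξ => f (ξ, η)) = (Ioi η).indicator fun ξ => k (ξ, η) • ψ η := by
    intro η
    ext1 ξ
    simp only [hf, hS, indicator, mem_ofPred_eq, mem_Ioi]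
  have hfξ : ∀ ξ : ℝ, (fun η => f (ξ, η)) = (Iio ξ).indicator fun η => k (ξ, η) • ψ η := by
    intro ξ
    ext1 η
    simp only [hf, hS, indicator, mem_ofPred_eq, mem_Iio]
  have hcap : ∀ η ∈ Ioc 0 τ, Ioc 0 τ ∩ Ioi η = Ioc η τ := by
    intro η hη
    ext ξ
    simp only [mem_inter_iff, mem_Ioc, mem_Ioi]
    exact ⟨fun h => ⟨h.2, h.1.2⟩, fun h => ⟨⟨hη.1.trans h.1, h.2⟩, h.1⟩⟩
  have hmem : ∀ᵐ η ∂μ, η ∈ Ioo 0 τ := by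
    have hne : ∀ᵐ ξ : ℝ, ξ ≠ τ := by simp [ae_iff, measure_singleton]
    filter_upwards [ae_restrict_mem measurableSet_Ioc, ae_restrict_of_ae hne] with η h1 h2
    exact ⟨h1.1, lt_of_le_of_ne h1.2 h2⟩
  have hkint : ∀ η ∈ Ioo 0 τ, IntegrableOn (fun ξ => k (ξ, η)) (Ioc η τ) := fun η hη =>
    (intervalIntegrable_iff_integrableOn_Ioc_of_le hη.2.le).1
      (intervalIntegrable_kernel_mul_kernel hα hη.2)
  have hkval : ∀ η ∈ Ioo 0 τ, ∫ ξ in Ioc η τ, k (ξ, η) =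
      Real.Gamma α * Real.Gamma (1 - α) := fun η hη => by
    rw [← intervalIntegral.integral_of_le hη.2.le]
    exact integral_kernel_mul_kernel hα hη.2
  have hIη : ∀ η ∈ Ioo 0 τ, Integrable (fun ξ => f (ξ, η)) μ := by
    intro η hη
    rw [hfη, integrable_indicator_iff measurableSet_Ioi, IntegrableOn, hμ,
      Measure.restrict_restrict measurableSet_Ioi, inter_comm, hcap η ⟨hη.1, hη.2.le⟩]
    exact (hkint η hη).smul_const _
  have hVη : ∀ η ∈ Ioo 0 τ, ∫ ξ, f (ξ, η) ∂μ =
      (Real.Gamma α * Real.Gamma (1 - α)) • ψ η := by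
    intro η hη
    rw [hfη, hμ, setIntegral_indicator measurableSet_Ioi, hcap η ⟨hη.1, hη.2.le⟩,
      integral_smul_const, hkval η hη]
  have hNη : ∀ η ∈ Ioo 0 τ, ∫ ξ, ‖f (ξ, η)‖ ∂μ =
      (Real.Gamma α * Real.Gamma (1 - α)) * ‖ψ η‖ := by
    intro η hη
    have h1 : (fun ξ => ‖f (ξ, η)‖) = (Ioi η).indicator fun ξ => ‖k (ξ, η) • ψ η‖ := by
      ext1 ξ
      rw [← norm_indicator_eq_indicator_norm]
      exact congrArg _ (congrFun (hfη η) ξ)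
    rw [h1, hμ, setIntegral_indicator measurableSet_Ioi, hcap η ⟨hη.1, hη.2.le⟩,
      ← hkval η hη, ← integral_mul_const]
    refine setIntegral_congr_fun measurableSet_Ioc fun ξ hξ => ?_
    rw [norm_smul, Real.norm_of_nonneg]
    exact mul_nonneg (inv_nonneg.2 (Real.rpow_nonneg (sub_nonneg.2 hξ.2) _))
      (inv_nonneg.2 (Real.rpow_nonneg (sub_nonneg.2 hξ.1.le) _))
  have hψμ : Integrable ψ μ :=
    (intervalIntegrable_iff_integrableOn_Ioc_of_le hτ).1 (intervalIntegrable_of_bounded hψ hM 0 τ)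
  -- Integrability is tested with `ξ` innermost, where the norm integrates to a constant times `‖ψ
  -- η‖`.
  have hint : Integrable f (μ.prod μ) := by
    rw [integrable_prod_iff' hfm.aestronglyMeasurable]
    refine ⟨hmem.mono hIη, (hψμ.norm.const_mul _).congr (hmem.mono fun η hη => (hNη η hη).symm)⟩
  have hswap := integral_integral_swap (f := fun ξ η => f (ξ, η)) hint
  have hright : ∫ η, ∫ ξ, f (ξ, η) ∂μ ∂μ =
      (Real.Gamma α * Real.Gamma (1 - α)) • ∫ ξ in (0 : ℝ)..τ, ψ ξ := by
    rw [intervalIntegral.integral_of_le hτ, ← integral_smul]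
    exact integral_congr_ae (hmem.mono hVη)
  have hleft : ∫ ξ, ∫ η, f (ξ, η) ∂μ ∂μ = ∫ ξ in (0 : ℝ)..τ, ((τ - ξ) ^ α)⁻¹ •
      ∫ η in (0 : ℝ)..ξ, ((ξ - η) ^ (1 - α))⁻¹ • ψ η := by
    rw [intervalIntegral.integral_of_le hτ]
    refine setIntegral_congr_fun measurableSet_Ioc fun ξ hξ => ?_
    have hcap' : Ioc 0 τ ∩ Iio ξ = Ioo 0 ξ := by
      ext η
      simp only [mem_inter_iff, mem_Ioc, mem_Ioo, mem_Iio]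
      exact ⟨fun h => ⟨h.1.1, h.2⟩, fun h => ⟨⟨h.1, h.2.le.trans hξ.2⟩, h.2⟩⟩
    rw [hfξ, hμ, setIntegral_indicator measurableSet_Iio, hcap', ← integral_Ioc_eq_integral_Ioo,
      intervalIntegral.integral_of_le hξ.1.le, ← integral_smul]
    simp only [hk, mul_smul]
  have hΓ : Real.Gamma α ≠ 0 := (Real.Gamma_pos_of_pos hα0).ne'
  have hΓ' : Real.Gamma (1 - α) ≠ 0 := (Real.Gamma_pos_of_pos (sub_pos.2 hα.2)).ne'
  simp only [rlIntegral, hα0.ne', hα1, if_false, sub_sub_cancel]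
  simp_rw [smul_comm _ (Real.Gamma α)⁻¹]
  rw [intervalIntegral.integral_smul, ← hleft, hswap, hright, smul_smul, smul_smul]
  rw [show (Real.Gamma (1 - α))⁻¹ * (Real.Gamma α)⁻¹ * (Real.Gamma α * Real.Gamma (1 - α)) = 1 by
    field_simp, one_smul]

/-- If `x = x(0) + I^α ψ` on `[0, t]`, then `ᶜD^α x = ψ` almost everywhere on `[0, t]`. -/
theorem caputoDeriv_ae_eq (hα : α ∈ Ioo (0 : ℝ) 1) (hψ : StronglyMeasurable ψ)
    (hM : ∀ ξ, ‖ψ ξ‖ ≤ M) {t : ℝ} {x : ℝ → Vec n}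
    (hx : ∀ τ ∈ Icc 0 t, x τ = x 0 + rlIntegral α ψ τ) :
    ∀ᵐ τ, τ ∈ Icc 0 t → caputoDeriv α x τ = ψ τ := by
  have hα1 : 1 - α ≠ 0 := (sub_pos.2 hα.2).ne'
  have h0 : ∀ᵐ τ : ℝ, τ ≠ 0 := by simp [ae_iff, measure_singleton]
  have h1 : ∀ᵐ τ : ℝ, τ ≠ t := by simp [ae_iff, measure_singleton]
  -- Near an interior `τ` the function being differentiated is the primitive of `ψ`, so Lebesgue
  -- differentiation applies.
  have hd := LocallyIntegrable.ae_hasDerivAt_integral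
    (f := ψ) (locallyIntegrable_const M |>.mono hψ.aestronglyMeasurable
      (.of_forall fun ξ => (hM ξ).trans (le_abs_self M)))
  filter_upwards [h0, h1, hd] with τ hτ0 hτt hτd hmem
  have hlt0 : 0 < τ := lt_of_le_of_ne hmem.1 hτ0.symm
  have hltt : τ < t := lt_of_le_of_ne hmem.2 hτt
  rw [caputoDeriv, ← (hτd 0).deriv]
  refine Filter.EventuallyEq.deriv_eq ?_
  filter_upwards [Ioo_mem_nhds hlt0 hltt] with r hr
  rw [← rlIntegral_rlIntegral hα hψ hM hr.1.le]
  refine rlIntegral_congr hα1 hr.1.le (.of_forall fun ξ hξ => ?_)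
  rw [hx ξ ⟨hξ.1.le, hξ.2.trans hr.2.le⟩, add_sub_cancel_left]

/-- The derivative is nonlocal but sees only the past. The point is interior because `deriv` is
two-sided. -/
theorem caputoDeriv_congr (hα : α ∈ Ioo (0 : ℝ) 1) {t : ℝ} {x y : ℝ → Vec n}
    (hxy : ∀ τ ∈ Icc 0 t, x τ = y τ) {τ : ℝ} (hτ : τ ∈ Ioo 0 t) :
    caputoDeriv α x τ = caputoDeriv α y τ := by
  refine Filter.EventuallyEq.deriv_eq ?_
  filter_upwards [Ioo_mem_nhds hτ.1 hτ.2] with r hr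
  refine rlIntegral_congr (sub_pos.2 hα.2).ne' hr.1.le (.of_forall fun ξ hξ => ?_)
  rw [hxy ξ ⟨hξ.1.le, hξ.2.trans hr.2.le⟩, hxy 0 ⟨le_rfl, (hr.1.trans hr.2).le⟩]

/-- `I^α` ignores null sets, so the density may be made measurable and bounded everywhere. -/
theorem IsAC.exists_bounded (hα : α ≠ 0) {t : ℝ} {x : C(Icc (0 : ℝ) t, Vec n)} (hx : IsAC α x) :
    ∃ (ψ : ℝ → Vec n) (M : ℝ), StronglyMeasurable ψ ∧ (∀ ξ, ‖ψ ξ‖ ≤ M) ∧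
      ∀ τ ∈ Icc 0 t, zeroExt x τ = zeroExt x 0 + rlIntegral α ψ τ := by
  obtain ⟨ψ, hψ, hx⟩ := hx
  obtain ⟨M, hM⟩ : ∃ M : ℝ, ∀ᵐ ξ ∂volume.restrict (Icc (0 : ℝ) t), ‖ψ ξ‖ ≤ M := by
    refine ⟨(eLpNormEssSup ψ (volume.restrict (Icc (0 : ℝ) t))).toReal, ?_⟩
    have htop : eLpNormEssSup ψ (volume.restrict (Icc (0 : ℝ) t)) ≠ ∞ := by
      rw [← eLpNorm_exponent_top]
      exact hψ.2.ne
    filter_upwards [ae_le_eLpNormEssSup (f := ψ) (μ := volume.restrict (Icc (0 : ℝ) t))] with ξ hξ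
    rw [← toReal_enorm]
    exact ENNReal.toReal_mono htop hξ
  set ψ₁ := hψ.1.mk ψ with hψ₁
  have hms : MeasurableSet {ξ | ‖ψ₁ ξ‖ ≤ M} :=
    hψ.1.stronglyMeasurable_mk.norm.measurable measurableSet_Iic
  -- The bound is `|M|` because the value `0` off the set needs a nonnegative bound and the sign of
  -- `M` is not recorded.
  refine ⟨{ξ | ‖ψ₁ ξ‖ ≤ M}.indicator ψ₁, |M|, hψ.1.stronglyMeasurable_mk.indicator hms, ?_, ?_⟩
  · intro ξ
    by_cases h : ξ ∈ {ξ | ‖ψ₁ ξ‖ ≤ M}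
    · rw [indicator_of_mem h]
      exact le_trans h (le_abs_self M)
    · rw [indicator_of_notMem h, norm_zero]
      exact abs_nonneg M
  · intro τ hτ
    rw [zeroExt, dif_pos hτ, hx ⟨τ, hτ⟩]
    congr 1
    refine rlIntegral_congr hα hτ.1 ?_
    have h1 := (ae_restrict_iff' measurableSet_Icc).1 hψ.1.ae_eq_mk
    have h2 := (ae_restrict_iff' measurableSet_Icc).1 hM
    filter_upwards [h1, h2] with ξ h1 h2 hmem
    have hmem' : ξ ∈ Icc 0 t := ⟨hmem.1.le, hmem.2.trans hτ.2⟩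
    rw [indicator_of_mem]
    · exact h1 hmem'
    · have := h2 hmem'
      rw [h1 hmem'] at this
      exact this

end Caputo

/-! ### Restriction and extension of paths. -/

section Paths

variable {n : ℕ} {α T : ℝ}

theorem zeroExt_of_mem {t : ℝ} (w : Icc (0 : ℝ) t → Vec n) {τ : ℝ} (h : τ ∈ Icc 0 t) :
    zeroExt w τ = w ⟨τ, h⟩ := dif_pos h

theorem continuousOn_zeroExt {t : ℝ} (w : C(Icc (0 : ℝ) t, Vec n)) :
    ContinuousOn (zeroExt w) (Icc 0 t) := by
  rw [continuousOn_iff_continuous_domRestrict]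
  refine w.continuous.congr fun τ => ?_
  rw [domRestrict_apply, zeroExt_of_mem _ τ.2]

theorem zeroExt_restr (x : ACFun α n T) (t : Icc (0 : ℝ) T) {τ : ℝ} (h : τ ∈ Icc 0 (t : ℝ)) :
    zeroExt (restr x t).1.w τ = zeroExt x.1 τ := by
  rw [zeroExt_of_mem x.1 ⟨h.1, h.2.trans t.2.2⟩]
  exact zeroExt_of_mem (t := t) _ h

theorem extends_restr (x : ACFun α n T) (t : Icc (0 : ℝ) T) : Extends x (restr x t).1 :=
  fun _ hτ => (zeroExt_restr x t hτ).symm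

theorem restr_eq_of_extends {x : ACFun α n T} {p : GA α n T} (h : Extends x p.1) :
    restr x p.1.t = p := by
  obtain ⟨⟨t, w⟩, hw⟩ := p
  refine Subtype.ext ?_
  change PathPt.mk t _ = PathPt.mk t w
  congr 1
  ext1 τ
  have h1 := h τ.1 τ.2
  rw [zeroExt_of_mem _ ⟨τ.2.1, τ.2.2.trans t.2.2⟩, zeroExt_of_mem _ τ.2] at h1
  exact h1

theorem endpoint_eq_of_extends {x : ACFun α n T} {p : PathPt n T} (h : Extends x p) :
    p.endpoint = zeroExt x.1 p.t := by
  rw [h _ ⟨p.t.2.1, le_rfl⟩, zeroExt_of_mem _ ⟨p.t.2.1, le_rfl⟩]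
  rfl

theorem dist_toLp_le (a b : ℝ) (u v : Vec n) :
    dist (WithLp.toLp 2 (a, u)) (WithLp.toLp 2 (b, v)) ≤ |a - b| + ‖u - v‖ := by
  rw [WithLp.prod_dist_eq_of_L2, Real.dist_eq, dist_eq_norm]
  refine Real.sqrt_le_iff.2 ⟨by positivity, ?_⟩
  have := mul_nonneg (abs_nonneg (a - b)) (norm_nonneg (u - v))
  change |a - b| ^ 2 + ‖u - v‖ ^ 2 ≤ _
  nlinarith

/-- The shorter graph is contained in the longer one; a point of the latter beyond time `t` is
compared with the endpoint at `t`. -/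
theorem dist_restr_le (x : ACFun α n T) {t t' : Icc (0 : ℝ) T} (htt : t ≤ t') {δ : ℝ}
    (h : ∀ r ∈ Icc (t : ℝ) t', (r - t) + ‖zeroExt x.1 r - zeroExt x.1 t‖ ≤ δ) :
    dist (restr x t) (restr x t') ≤ δ := by
  have htt' : (t : ℝ) ≤ t' := htt
  have hδ : 0 ≤ δ := by
    have := h t ⟨le_rfl, htt'⟩
    simpa using this
  change Metric.hausdorffDist
    (range fun τ : Icc (0 : ℝ) (t : ℝ) => WithLp.toLp 2 ((τ : ℝ), (restr x t).1.w τ))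
    (range fun τ : Icc (0 : ℝ) (t' : ℝ) => WithLp.toLp 2 ((τ : ℝ), (restr x t').1.w τ)) ≤ δ
  refine Metric.hausdorffDist_le_of_mem_dist hδ ?_ ?_
  · rintro _ ⟨τ, rfl⟩
    refine ⟨_, ⟨⟨τ, τ.2.1, τ.2.2.trans htt'⟩, rfl⟩, ?_⟩
    refine le_of_eq_of_le ?_ hδ
    exact dist_self _
  · rintro _ ⟨τ, rfl⟩
    rcases le_total (τ : ℝ) t with hτ | hτ
    · refine ⟨_, ⟨⟨τ, τ.2.1, hτ⟩, rfl⟩, ?_⟩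
      refine le_of_eq_of_le ?_ hδ
      exact dist_self _
    · refine ⟨_, ⟨⟨t, t.2.1, le_rfl⟩, rfl⟩, (dist_toLp_le _ _ _ _).trans ?_⟩
      have h1 := h τ ⟨hτ, τ.2.2⟩
      rw [abs_of_nonneg (sub_nonneg.2 hτ)]
      rw [zeroExt_of_mem _ ⟨τ.2.1, τ.2.2.trans t'.2.2⟩, zeroExt_of_mem _ t.2] at h1
      exact h1

theorem continuous_restr (x : ACFun α n T) : Continuous (restr x) := by
  have hu := CompactSpace.uniformContinuous_of_continuous x.1.continuous
  rw [Metric.uniformContinuous_iff] at hu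
  rw [Metric.continuous_iff]
  intro t ε hε
  obtain ⟨δ, hδ, hu⟩ := hu (ε / 3) (by positivity)
  have key : ∀ t t' : Icc (0 : ℝ) T, t ≤ t' → dist t t' < min δ (ε / 3) →
      dist (restr x t) (restr x t') < ε := by
    intro t t' htt hd
    have htt' : (t : ℝ) ≤ t' := htt
    have h1 : (t' : ℝ) - t < min δ (ε / 3) := by
      rwa [Subtype.dist_eq, dist_comm, Real.dist_eq, abs_of_nonneg (sub_nonneg.2 htt')] at hd
    refine (dist_restr_le x htt (δ := ε / 3 + ε / 3) fun r hr => ?_).trans_lt (by linarith)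
    have hrT : r ∈ Icc 0 T := ⟨t.2.1.trans hr.1, hr.2.trans t'.2.2⟩
    refine add_le_add (by linarith [h1.trans_le (min_le_right _ _), hr.2]) ?_
    rw [zeroExt_of_mem _ hrT, zeroExt_of_mem _ t.2, ← dist_eq_norm]
    refine (hu ?_).le
    rw [Subtype.dist_eq, Real.dist_eq, abs_of_nonneg (sub_nonneg.2 hr.1)]
    linarith [h1.trans_le (min_le_left _ _), hr.2]
  refine ⟨min δ (ε / 3), by positivity, fun t' hd => ?_⟩
  rcases le_total t' t with h | h
  · exact key t' t h hd
  · rw [dist_comm]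
    exact key t t' h (by rwa [dist_comm])

theorem exists_acFun (hα : α ∈ Ioo (0 : ℝ) 1) (hT : 0 ≤ T) {ψ : ℝ → Vec n} {M : ℝ}
    (hψ : StronglyMeasurable ψ) (hM : ∀ ξ, ‖ψ ξ‖ ≤ M) (v : Vec n) :
    ∃ x : ACFun α n T, ∀ τ ∈ Icc 0 T, zeroExt x.1 τ = v + rlIntegral α ψ τ := by
  have hc : Continuous fun τ : Icc (0 : ℝ) T => v + rlIntegral α ψ τ := by
    have h : ContinuousOn (rlIntegral α ψ) (Icc 0 T) :=
      (continuousOn_rlIntegral hα hψ hM).mono fun _ h => h.1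
    exact continuous_const.add (continuousOn_iff_continuous_domRestrict.1 h)
  have h0 : zeroExt (fun τ : Icc (0 : ℝ) T => v + rlIntegral α ψ τ) 0 = v := by
    rw [zeroExt_of_mem _ ⟨le_rfl, hT⟩]
    simp [rlIntegral_zero hα.1.ne']
  refine ⟨⟨⟨_, hc⟩, ψ, ?_, ?_⟩, ?_⟩
  · exact memLp_top_of_bound hψ.aestronglyMeasurable M (.of_forall hM)
  · intro τ
    change v + rlIntegral α ψ τ = zeroExt (fun τ : Icc (0 : ℝ) T => v + rlIntegral α ψ τ) 0 + _
    rw [h0]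
  · intro τ hτ
    rw [zeroExt_of_mem _ hτ]
    rfl

/-- Every path extends to `[0, T]` with a prescribed constant Caputo derivative. -/
theorem exists_extends_caputoDeriv_eq (hα : α ∈ Ioo (0 : ℝ) 1) (p : GA α n T) (v : Vec n) :
    ∃ x : ACFun α n T, Extends x p.1 ∧
      ∀ᵐ τ, τ ∈ Ioc (p.1.t : ℝ) T → caputoDeriv α (zeroExt x.1) τ = v := by
  have hT : 0 ≤ T := p.1.t.2.1.trans p.1.t.2.2
  obtain ⟨ψ, M, hψ, hM, hw⟩ := IsAC.exists_bounded hα.1.ne' p.2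
  classical
  have hψ' : StronglyMeasurable ((Iic (p.1.t : ℝ)).piecewise ψ fun _ => v) :=
    hψ.piecewise measurableSet_Iic stronglyMeasurable_const
  have hM' : ∀ ξ, ‖(Iic (p.1.t : ℝ)).piecewise ψ (fun _ => v) ξ‖ ≤ max M ‖v‖ := by
    intro ξ
    by_cases h : ξ ∈ Iic (p.1.t : ℝ)
    · rw [piecewise_eq_of_mem _ _ _ h]
      exact (hM ξ).trans (le_max_left _ _)
    · rw [piecewise_eq_of_notMem _ _ _ h]
      exact le_max_right _ _
  obtain ⟨x, hx⟩ := exists_acFun (T := T) hα hT hψ' hM' (zeroExt p.1.w 0)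
  have hx0 : zeroExt x.1 0 = zeroExt p.1.w 0 := by
    rw [hx 0 ⟨le_rfl, hT⟩, rlIntegral_zero hα.1.ne', add_zero]
  refine ⟨x, fun τ hτ => ?_, ?_⟩
  · rw [hx τ ⟨hτ.1, hτ.2.trans p.1.t.2.2⟩, hw τ hτ]
    congr 1
    refine rlIntegral_congr hα.1.ne' hτ.1 (.of_forall fun ξ hξ => ?_)
    exact piecewise_eq_of_mem _ _ _ (hξ.2.trans hτ.2)
  · have h := caputoDeriv_ae_eq hα hψ' hM' (x := zeroExt x.1) (t := T) (fun τ hτ => by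
      rw [hx0, hx τ hτ])
    filter_upwards [h] with τ hτ hmem
    rw [hτ ⟨p.1.t.2.1.trans hmem.1.le, hmem.2⟩]
    exact piecewise_eq_of_notMem _ _ _ (not_le.2 hmem.1)

end Paths

/-! ### Calculus of a `ci`-smooth functional along a path. -/

section Path

variable {n : ℕ} {α T : ℝ}

/-- The path `t ↦ (t, x_t(·))`, frozen outside `[0, t₁]`. -/
noncomputable def pathCurve (x : ACFun α n T) {t₁ : ℝ} (h0 : 0 ≤ t₁) (h1 : t₁ < T) (r : ℝ) :
    GAo α n T :=
  ⟨restr x ⟨projIcc 0 t₁ h0 r, (projIcc 0 t₁ h0 r).2.1, (projIcc 0 t₁ h0 r).2.2.trans h1.le⟩,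
    (projIcc 0 t₁ h0 r).2.2.trans_lt h1⟩

theorem continuous_pathCurve (x : ACFun α n T) {t₁ : ℝ} (h0 : 0 ≤ t₁) (h1 : t₁ < T) :
    Continuous (pathCurve x h0 h1) := by
  refine Continuous.subtype_mk ((continuous_restr x).comp ?_) _
  exact Continuous.subtype_mk (continuous_subtype_val.comp continuous_projIcc) _

theorem pathCurve_val (x : ACFun α n T) {t₁ : ℝ} (h0 : 0 ≤ t₁) (h1 : t₁ < T) {r : ℝ}
    (hr : r ∈ Icc 0 t₁) :
    (pathCurve x h0 h1 r).1 = restr x ⟨r, hr.1, hr.2.trans h1.le⟩ := by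
  simp only [pathCurve, projIcc_of_mem h0 hr]

theorem HasCiDerivAt.isLittleO_right {φ : GA α n T → ℝ} {p : GAo α n T} {a : ℝ} {g : Vec n}
    (h : HasCiDerivAt φ p a g) {x : ACFun α n T} (hx : Extends x p.1.1) (hT : 0 ≤ T) :
    (fun t : ℝ => φ (restr x (projIcc 0 T hT t)) - φ p.1 - a * (t - p.1.1.t)
        - ∫ τ in (p.1.1.t : ℝ)..t, inner ℝ g (caputoDeriv α (zeroExt x.1) τ))
      =o[𝓝[>] (p.1.1.t : ℝ)] fun t : ℝ => t - p.1.1.t := by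
  have hev : ∀ᶠ t : ℝ in 𝓝[>] (p.1.1.t : ℝ), t ∈ Ioo (p.1.1.t : ℝ) T :=
    Ioo_mem_nhdsGT p.2
  have htend : Tendsto (projIcc 0 T hT) (𝓝[>] (p.1.1.t : ℝ)) (𝓝[>] p.1.1.t) := by
    refine tendsto_nhdsWithin_iff.2 ⟨?_, ?_⟩
    · have := (continuous_projIcc (h := hT)).tendsto (p.1.1.t : ℝ)
      rw [projIcc_val] at this
      exact this.mono_left nhdsWithin_le_nhds
    · filter_upwards [hev] with t ht
      rw [projIcc_of_mem hT ⟨p.1.1.t.2.1.trans ht.1.le, ht.2.le⟩]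
      exact ht.1
  have hval : ∀ᶠ t : ℝ in 𝓝[>] (p.1.1.t : ℝ), (projIcc 0 T hT t : ℝ) = t := by
    filter_upwards [hev] with t ht
    rw [projIcc_of_mem hT ⟨p.1.1.t.2.1.trans ht.1.le, ht.2.le⟩]
  refine ((h x hx).comp_tendsto htend).congr' ?_ ?_
  · filter_upwards [hval] with t ht
    simp only [Function.comp_apply, ht]
  · filter_upwards [hval] with t ht
    simp only [Function.comp_apply, ht]

theorem inner_integrable {ψ : ℝ → Vec n} {M : ℝ} (hψ : StronglyMeasurable ψ)
    (hM : ∀ ξ, ‖ψ ξ‖ ≤ M) {G : ℝ → Vec n} (hG : Continuous G) (c d : ℝ) :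
    IntervalIntegrable (fun r => (inner ℝ (G r) (ψ r) : ℝ)) volume c d := by
  refine IntervalIntegrable.mono_fun' (g := fun r => ‖G r‖ * M)
    ((hG.norm.mul continuous_const).intervalIntegrable _ _)
    (hG.stronglyMeasurable.inner hψ).aestronglyMeasurable (.of_forall fun r => ?_)
  exact (norm_inner_le_norm _ _).trans (mul_le_mul_of_nonneg_left (hM r) (norm_nonneg _))

/-- The fundamental theorem of calculus for a `ci`-smooth functional along a path. -/
theorem sub_eq_integral_of_hasCiDerivAt {φ : GA α n T → ℝ} (hφ : Continuous φ)
    {a : GAo α n T → ℝ} {g : GAo α n T → Vec n} (hd : ∀ p, HasCiDerivAt φ p (a p) (g p))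
    (ha : Continuous a) (hg : Continuous g) (x : ACFun α n T) {ψ : ℝ → Vec n} {M : ℝ}
    (hψ : StronglyMeasurable ψ) (hM : ∀ ξ, ‖ψ ξ‖ ≤ M)
    (hxψ : ∀ᵐ τ, τ ∈ Icc 0 T → caputoDeriv α (zeroExt x.1) τ = ψ τ)
    {t₀ t₁ : ℝ} (h0 : 0 ≤ t₀) (h01 : t₀ ≤ t₁) (h1 : t₁ < T) :
    φ (pathCurve x (h0.trans h01) h1 t₁).1 - φ (pathCurve x (h0.trans h01) h1 t₀).1 =
      ∫ r in t₀..t₁, (a (pathCurve x (h0.trans h01) h1 r) +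
        inner ℝ (g (pathCurve x (h0.trans h01) h1 r)) (ψ r)) := by
  have h0t : 0 ≤ t₁ := h0.trans h01
  have hT : 0 ≤ T := h0t.trans h1.le
  set c := pathCurve x h0t h1 with hc
  have hcc : Continuous c := continuous_pathCurve x h0t h1
  have hac : Continuous fun r => a (c r) := ha.comp hcc
  have hgc : Continuous fun r => g (c r) := hg.comp hcc
  set f : ℝ → ℝ := fun r => a (c r) + inner ℝ (g (c r)) (ψ r) with hf
  have hfi : ∀ u v : ℝ, IntervalIntegrable f volume u v := fun u v =>
    (hac.intervalIntegrable u v).add (inner_integrable hψ hM hgc u v)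
  have hM0 : 0 ≤ M := (norm_nonneg _).trans (hM 0)
  set F : ℝ → ℝ := fun t => φ (c t).1 - ∫ r in t₀..t, f r with hF
  have hFc : Continuous F :=
    (hφ.comp (continuous_subtype_val.comp hcc)).sub
      (intervalIntegral.continuous_primitive hfi t₀)
  -- `ci`-differentiability controls only the future of `τ`; a vanishing right derivative together
  -- with continuity is enough for constancy.
  have hder : ∀ τ ∈ Ico t₀ t₁, HasDerivWithinAt F 0 (Ici τ) τ := by
    intro τ hτ
    have hτ0 : 0 ≤ τ := h0.trans hτ.1
    have hτI : τ ∈ Icc 0 t₁ := ⟨hτ0, hτ.2.le⟩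
    have hcτ : (c τ).1 = restr x ⟨τ, hτ0, hτ.2.le.trans h1.le⟩ := pathCurve_val x h0t h1 hτI
    have hext : Extends x (c τ).1.1 := by
      rw [hcτ]
      exact extends_restr x _
    have hct : ((c τ).1.1.t : ℝ) = τ := by rw [hcτ]; rfl
    have hlo := (hd (c τ)).isLittleO_right hext hT
    rw [hct] at hlo
    rw [← hasDerivWithinAt_Ioi_iff_Ici, hasDerivWithinAt_iff_isLittleO]
    -- Since `ψ` is merely measurable, `∫ f` need not be differentiable at `τ`. Subtracting the
    -- integral with frozen `a`, `g` but the same `ψ` leaves differences that are small by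
    -- continuity, at every `τ`.
    have hloF : (fun t : ℝ => ∫ r in τ..t, (f r - a (c τ) - inner ℝ (g (c τ)) (ψ r)))
        =o[𝓝[>] τ] fun t : ℝ => t - τ := by
      rw [isLittleO_iff]
      intro ε hε
      have he : Continuous fun r => |a (c r) - a (c τ)| + ‖g (c r) - g (c τ)‖ * M := by fun_prop
      have hnear : ∀ᶠ r in 𝓝 τ, |a (c r) - a (c τ)| + ‖g (c r) - g (c τ)‖ * M < ε := by
        refine he.continuousAt.eventually_lt_const ?_
        simpa using hε
      obtain ⟨δ, hδ, hball⟩ := Metric.eventually_nhds_iff.1 hnear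
      filter_upwards [Ioo_mem_nhdsGT (show τ < τ + δ by linarith)] with t ht
      rw [Real.norm_eq_abs (t - τ)]
      refine intervalIntegral.norm_integral_le_of_norm_le_const fun r hr => ?_
      rw [uIoc_of_le ht.1.le] at hr
      have hr' : dist r τ < δ := by
        rw [Real.dist_eq, abs_of_pos (by linarith [hr.1])]
        linarith [hr.2, ht.2]
      have heq : f r - a (c τ) - inner ℝ (g (c τ)) (ψ r) =
          (a (c r) - a (c τ)) + inner ℝ (g (c r) - g (c τ)) (ψ r) := by
        rw [hf, inner_sub_left]
        ring
      rw [heq]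
      refine (norm_add_le _ _).trans ((add_le_add le_rfl ?_).trans (hball hr').le)
      exact (norm_inner_le_norm _ _).trans (mul_le_mul_of_nonneg_left (hM r) (norm_nonneg _))
    refine (hlo.sub hloF).congr' ?_ .rfl
    filter_upwards [Ioo_mem_nhdsGT hτ.2] with t ht
    have ht0 : 0 ≤ t := hτ0.trans ht.1.le
    have htT : t ≤ T := ht.2.le.trans h1.le
    have hct' : (c t).1 = restr x (projIcc 0 T hT t) := by
      rw [projIcc_of_mem hT ⟨ht0, htT⟩]
      exact pathCurve_val x h0t h1 ⟨ht0, ht.2.le⟩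
    have hD : ∫ r in τ..t, inner ℝ (g (c τ)) (caputoDeriv α (zeroExt x.1) r) =
        ∫ r in τ..t, inner ℝ (g (c τ)) (ψ r) := by
      refine intervalIntegral.integral_congr_ae ?_
      filter_upwards [hxψ] with r hr hmem
      rw [uIoc_of_le ht.1.le] at hmem
      rw [hr ⟨hτ0.trans hmem.1.le, hmem.2.trans htT⟩]
    have hi := inner_integrable hψ hM (continuous_const (y := g (c τ))) τ t
    rw [hD, intervalIntegral.integral_sub ((hfi τ t).sub intervalIntegrable_const) hi,
      intervalIntegral.integral_sub (hfi τ t) intervalIntegrable_const,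
      intervalIntegral.integral_const, hF]
    simp only [smul_eq_mul, mul_zero, sub_zero]
    rw [← hct', ← intervalIntegral.integral_add_adjacent_intervals (hfi t₀ τ) (hfi τ t)]
    ring
  have hconst := constant_of_has_deriv_right_zero hFc.continuousOn hder t₁ ⟨h01, le_rfl⟩
  simp only [hF, intervalIntegral.integral_same, sub_zero] at hconst
  linarith

end Path

/-! ### Uniform estimates over characteristics. -/

section Characteristics

variable {n : ℕ} {α T : ℝ}

/-- The extensions of a path with sublinearly bounded Caputo derivative are equicontinuous at
the final time of the path. -/
theorem exists_forall_norm_sub_le (hα : α ∈ Ioo (0 : ℝ) 1) {cH : ℝ} (hcH : 0 < cH)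
    (p : GA α n T) {η : ℝ} (hη : 0 < η) :
    ∃ δ > 0, ∀ x : ACFun α n T, Extends x p.1 →
      (∀ᵐ t, t ∈ Icc (p.1.t : ℝ) T →
        ‖caputoDeriv α (zeroExt x.1) t‖ ≤ cH * (1 + ‖zeroExt x.1 t‖)) →
      ∀ t ∈ Icc (p.1.t : ℝ) T, t ≤ p.1.t + δ → ‖zeroExt x.1 t - p.1.endpoint‖ ≤ η := by
  obtain ⟨ψ₀, M₀, hψ₀, hM₀, hw⟩ := IsAC.exists_bounded hα.1.ne' p.2
  have hM₀0 : 0 ≤ M₀ := (norm_nonneg _).trans (hM₀ 0)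
  set t₀ := (p.1.t : ℝ)
  have ht₀0 : 0 ≤ t₀ := p.1.t.2.1
  have ht₀T : t₀ ≤ T := p.1.t.2.2
  set e := p.1.endpoint with he
  set K : ℝ := (Real.Gamma α)⁻¹ / α with hK
  have hKpos : 0 < K := div_pos (inv_pos.2 (Real.Gamma_pos_of_pos hα.1)) hα.1
  set A : ℝ := M₀ + cH * (1 + ‖e‖) with hA
  have hlim : Tendsto (fun δ : ℝ => δ ^ α) (𝓝[>] 0) (𝓝 0) := by
    have h := (Real.continuous_rpow_const hα.1.le).tendsto 0
    rw [Real.zero_rpow hα.1.ne'] at h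
    exact h.mono_left nhdsWithin_le_nhds
  -- The maximal deviation `N` will satisfy `N ≤ K (A + cH N) δ^α`. This choice absorbs the `N` on
  -- the right into half of the left side; `e2` then makes the rest at most `η`.
  have e1 : ∀ᶠ δ : ℝ in 𝓝[>] 0, K * cH * δ ^ α < 1 / 2 := by
    have h := hlim.const_mul (K * cH)
    rw [mul_zero] at h
    exact h.eventually_lt_const (by norm_num)
  have e2 : ∀ᶠ δ : ℝ in 𝓝[>] 0, 2 * K * A * δ ^ α < η := by
    have h := hlim.const_mul (2 * K * A)
    rw [mul_zero] at h
    exact h.eventually_lt_const hη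
  obtain ⟨δ, ⟨h1, h2⟩, hδ⟩ := ((e1.and e2).and self_mem_nhdsWithin).exists
  refine ⟨δ, hδ, fun x hx hD t ht htδ => ?_⟩
  obtain ⟨ψ, M, hψ, hM, hxψ⟩ := IsAC.exists_bounded hα.1.ne' x.2
  have hae := caputoDeriv_ae_eq hα hψ hM hxψ
  have hae₀ := caputoDeriv_ae_eq hα hψ₀ hM₀ hw
  have hXe : e = zeroExt x.1 t₀ := endpoint_eq_of_extends hx
  have hcont : ContinuousOn (fun r => ‖zeroExt x.1 r - e‖) (Icc t₀ t) :=
    (((continuousOn_zeroExt x.1).mono (Icc_subset_Icc ht₀0 ht.2)).sub continuousOn_const).norm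
  obtain ⟨r, hr, hmax⟩ := isCompact_Icc.exists_isMaxOn ⟨t₀, le_rfl, ht.1⟩ hcont
  set N := ‖zeroExt x.1 r - e‖ with hN
  have hN' : ∀ s ∈ Icc t₀ t, ‖zeroExt x.1 s - e‖ ≤ N := fun s hs => hmax hs
  have hrT : r ≤ T := hr.2.trans ht.2
  have hne : ∀ᵐ ξ : ℝ, ξ ≠ t₀ := by simp [ae_iff, measure_singleton]
  -- On the past the density of `x` agrees a.e. with that of the given path, so the bound, and hence
  -- `δ`, is independent of `x`.
  have b0 : ∀ᵐ ξ, ξ ∈ Ioc 0 t₀ → ‖ψ ξ‖ ≤ M₀ := by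
    filter_upwards [hae, hae₀, hne] with ξ g1 g2 g3 hξ
    have hlt : ξ < t₀ := lt_of_le_of_ne hξ.2 g3
    rw [← g1 ⟨hξ.1.le, hξ.2.trans ht₀T⟩, caputoDeriv_congr hα hx ⟨hξ.1, hlt⟩,
      g2 ⟨hξ.1.le, hξ.2⟩]
    exact hM₀ ξ
  have b1 : ∀ᵐ ξ, ξ ∈ Ioc t₀ r → ‖ψ ξ‖ ≤ cH * (1 + (‖e‖ + N)) := by
    filter_upwards [hae, hD] with ξ g1 g2 hξ
    have hξT : ξ ≤ T := hξ.2.trans hrT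
    rw [← g1 ⟨ht₀0.trans hξ.1.le, hξT⟩]
    refine (g2 ⟨hξ.1.le, hξT⟩).trans ?_
    have g3 := hN' ξ ⟨hξ.1.le, hξ.2.trans hr.2⟩
    have g4 := norm_add_le e (zeroExt x.1 ξ - e)
    rw [add_sub_cancel] at g4
    gcongr
    linarith
  have hest := norm_rlIntegral_sub_le hα hψ hM ht₀0 hr.1 hM₀0 b0 b1
  have hNeq : N = ‖rlIntegral α ψ r - rlIntegral α ψ t₀‖ := by
    rw [hN, hXe, hxψ r ⟨ht₀0.trans hr.1, hrT⟩, hxψ t₀ ⟨ht₀0, ht₀T⟩, add_sub_add_left_eq_sub]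
  rw [← hNeq] at hest
  have hN0 : 0 ≤ N := norm_nonneg _
  have hpow : (r - t₀) ^ α ≤ δ ^ α :=
    Real.rpow_le_rpow (sub_nonneg.2 hr.1) (by linarith [hr.2]) hα.1.le
  have hfin : N ≤ K * (A + cH * N) * δ ^ α := by
    calc N ≤ K * (A + cH * N) * (r - t₀) ^ α := hest.trans (le_of_eq (by rw [hK, hA]; ring))
      _ ≤ _ := by gcongr
  have h3 : K * cH * δ ^ α * N ≤ 1 / 2 * N := mul_le_mul_of_nonneg_right h1.le hN0
  have h4 := hN' t ⟨ht.1, le_rfl⟩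
  nlinarith

/-- The increment of a `ci`-smooth functional along the characteristics with parameter
`s = ∇^α φ(p)` is, uniformly in the characteristic, of first order with coefficient
`∂_t^α φ(p) + H(p, ∇^α φ(p))`. -/
theorem exists_forall_characteristic_le (hα : α ∈ Ioo (0 : ℝ) 1) {cH : ℝ} (hcH : 0 < cH)
    {H : ℝ → Vec n → Vec n → ℝ}
    (hH : ContinuousOn (fun q : ℝ × Vec n × Vec n => H q.1 q.2.1 q.2.2) (Icc 0 T ×ˢ univ))
    {φ : GA α n T → ℝ} (hφ : Continuous φ)
    {a : GAo α n T → ℝ} {g : GAo α n T → Vec n} (hd : ∀ p, HasCiDerivAt φ p (a p) (g p))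
    (ha : Continuous a) (hg : Continuous g) (p : GAo α n T) {η : ℝ} (hη : 0 < η) :
    ∃ δ > 0, ∀ t : Icc (0 : ℝ) T, p.1.1.t < t → (t : ℝ) ≤ p.1.1.t + δ →
      ∀ (x : ACFun α n T) (z : ℝ → ℝ), IsCharacteristic cH H p.1.1 0 (g p) x z →
        |φ (restr x t) - z t - φ p.1 -
          (a p + H p.1.1.t p.1.1.endpoint (g p)) * (t - p.1.1.t)| ≤ η * (t - p.1.1.t) := by
  set t₀ := (p.1.1.t : ℝ) with ht₀
  have ht₀0 : 0 ≤ t₀ := p.1.1.t.2.1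
  have ht₀T : t₀ < T := p.2
  set e := p.1.1.endpoint with he
  set s := g p with hs
  -- Bounds the Caputo derivative while the path stays within distance `1` of `e`; the cap `ρ ≤ 1`
  -- below ensures this.
  set B : ℝ := cH * (1 + (‖e‖ + 1)) with hB
  have hBpos : 0 < B := by positivity
  obtain ⟨ρ₁, hρ₁, ha'⟩ := Metric.continuous_iff.1 ha p (η / 3) (by positivity)
  obtain ⟨ρ₂, hρ₂, hg'⟩ := Metric.continuous_iff.1 hg p (η / (3 * B)) (by positivity)
  obtain ⟨ρ₃, hρ₃, hH'⟩ := Metric.continuousWithinAt_iff.1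
    (hH (t₀, e, s) ⟨⟨ht₀0, ht₀T.le⟩, mem_univ _⟩) (η / 3) (by positivity)
  set ρ := min ρ₁ (min ρ₂ (min ρ₃ 1)) with hρ
  have hρpos : 0 < ρ := by positivity
  have hρ1 : ρ ≤ ρ₁ := min_le_left _ _
  have hρ2 : ρ ≤ ρ₂ := (min_le_right _ _).trans (min_le_left _ _)
  have hρ3 : ρ ≤ ρ₃ := (min_le_right _ _).trans ((min_le_right _ _).trans (min_le_left _ _))
  have hρ4 : ρ ≤ 1 := (min_le_right _ _).trans ((min_le_right _ _).trans (min_le_right _ _))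
  obtain ⟨δ₀, hδ₀, hX⟩ := exists_forall_norm_sub_le hα hcH p.1 (η := ρ / 3) (by positivity)
  have hT₀ : 0 < T - t₀ := sub_pos.2 ht₀T
  -- Time and space increments of at most `ρ / 3` each keep the curve strictly within `ρ` of `p`;
  -- the last term keeps `t < T`, where the `ci`-derivatives live.
  refine ⟨min δ₀ (min (ρ / 3) ((T - t₀) / 2)), by positivity, fun t htgt htδ x z hxz => ?_⟩
  obtain ⟨hext, ⟨Kz, hz⟩, hz0, hae⟩ := hxz
  rw [ae_restrict_iff' measurableSet_Icc] at hae
  have htgt' : t₀ < t := htgt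
  have d1 : (t : ℝ) ≤ t₀ + δ₀ := htδ.trans (by gcongr; exact min_le_left _ _)
  have d2 : (t : ℝ) ≤ t₀ + ρ / 3 :=
    htδ.trans (by gcongr; exact (min_le_right _ _).trans (min_le_left _ _))
  have d3 : (t : ℝ) ≤ t₀ + (T - t₀) / 2 :=
    htδ.trans (by gcongr; exact (min_le_right _ _).trans (min_le_right _ _))
  have htT : (t : ℝ) < T := by linarith
  have hnear : ∀ r ∈ Icc t₀ (t : ℝ), ‖zeroExt x.1 r - e‖ ≤ ρ / 3 := fun r hr =>
    hX x hext (hae.mono fun u hu hmem => (hu hmem).1) r ⟨hr.1, hr.2.trans htT.le⟩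
      (hr.2.trans d1)
  have hXe : e = zeroExt x.1 t₀ := endpoint_eq_of_extends hext
  obtain ⟨ψ, M, hψ, hM, hxψ⟩ := IsAC.exists_bounded hα.1.ne' x.2
  have haeψ := caputoDeriv_ae_eq hα hψ hM hxψ
  have hftc := sub_eq_integral_of_hasCiDerivAt hφ hd ha hg x hψ hM haeψ ht₀0 htgt'.le htT
  set h0t : 0 ≤ (t : ℝ) := ht₀0.trans htgt'.le
  set c := pathCurve x h0t htT with hc
  have hcc : Continuous c := continuous_pathCurve x h0t htT
  have hct : (c t).1 = restr x t := pathCurve_val x h0t htT ⟨h0t, le_rfl⟩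
  have hrest : restr x p.1.1.t = p.1 := restr_eq_of_extends hext
  have hct₀ : (c t₀).1 = p.1 := (pathCurve_val x h0t htT ⟨ht₀0, htgt'.le⟩).trans hrest
  rw [hct, hct₀] at hftc
  have hdist : ∀ r ∈ Icc t₀ (t : ℝ), dist (c r) p < ρ := by
    intro r hr
    rw [dist_comm, Subtype.dist_eq, pathCurve_val x h0t htT ⟨ht₀0.trans hr.1, hr.2⟩, ← hrest]
    refine (dist_restr_le x (δ := ρ / 3 + ρ / 3) hr.1 fun u hu => ?_).trans_lt (by linarith)
    have hu' : u ≤ t := hu.2.trans hr.2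
    refine add_le_add (by linarith) ?_
    rw [← ht₀, ← hXe]
    exact hnear u ⟨hu.1, hu'⟩
  have hzac : AbsolutelyContinuousOnInterval z t₀ t := by
    refine LipschitzOnWith.absolutelyContinuousOnInterval (K := Kz) ?_
    rw [uIcc_of_le htgt'.le]
    exact hz.mono (Icc_subset_Icc ht₀0 htT.le)
  have hzint := hzac.integral_deriv_eq_sub
  rw [hz0 t₀ ⟨ht₀0, le_rfl⟩, sub_zero] at hzint
  have hfi : IntervalIntegrable (fun r => a (c r) + inner ℝ (g (c r)) (ψ r)) volume t₀ t :=
    ((ha.comp hcc).intervalIntegrable _ _).add (inner_integrable hψ hM (hg.comp hcc) _ _)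
  have hrepr : φ (restr x t) - z t - φ p.1 - (a p + H t₀ e s) * (t - t₀) =
      ∫ r in t₀..t, (a (c r) + inner ℝ (g (c r)) (ψ r) - deriv z r - (a p + H t₀ e s)) := by
    rw [intervalIntegral.integral_sub (hfi.sub hzac.intervalIntegrable_deriv)
      intervalIntegrable_const, intervalIntegral.integral_sub hfi hzac.intervalIntegrable_deriv,
      ← hftc, hzint, intervalIntegral.integral_const, smul_eq_mul]
    ring
  rw [hrepr]
  have hbound := intervalIntegral.norm_integral_le_of_norm_le_const_ae (a := t₀) (b := t) (C := η)
    (f := fun r => a (c r) + inner ℝ (g (c r)) (ψ r) - deriv z r - (a p + H t₀ e s)) ?_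
  · rwa [Real.norm_eq_abs, abs_of_pos (sub_pos.2 htgt')] at hbound
  filter_upwards [hae, haeψ] with r h1 h2 hmem
  rw [uIoc_of_le htgt'.le] at hmem
  have hr : r ∈ Icc t₀ (t : ℝ) := ⟨hmem.1.le, hmem.2⟩
  have hrT : r ≤ T := hmem.2.trans htT.le
  obtain ⟨k1, k2⟩ := h1 ⟨hmem.1.le, hrT⟩
  simp only at k1 k2
  rw [h2 ⟨ht₀0.trans hmem.1.le, hrT⟩] at k1 k2
  have hψB : ‖ψ r‖ ≤ B := by
    refine k1.trans ?_
    have g4 := norm_add_le e (zeroExt x.1 r - e)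
    rw [add_sub_cancel] at g4
    have := hnear r hr
    rw [hB]
    gcongr
    linarith
  have n1 : |a (c r) - a p| < η / 3 := ha' _ ((hdist r hr).trans_le hρ1)
  have n2 : ‖g (c r) - s‖ < η / (3 * B) := by
    rw [← dist_eq_norm]
    exact hg' _ ((hdist r hr).trans_le hρ2)
  have n3 : |H r (zeroExt x.1 r) s - H t₀ e s| < η / 3 := by
    refine hH' (x := (r, zeroExt x.1 r, s)) ⟨⟨ht₀0.trans hr.1, hrT⟩, mem_univ _⟩ ?_
    rw [Prod.dist_eq, Prod.dist_eq, dist_self]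
    refine max_lt ?_ (max_lt ?_ hρ₃)
    · rw [Real.dist_eq, abs_of_nonneg (sub_nonneg.2 hr.1)]
      linarith [hr.2]
    · rw [dist_eq_norm]
      linarith [hnear r hr]
  have n4 : |inner ℝ (g (c r) - s) (ψ r)| ≤ η / 3 := by
    calc _ ≤ ‖g (c r) - s‖ * ‖ψ r‖ := abs_real_inner_le_norm _ _
      _ ≤ η / (3 * B) * B := by gcongr
      _ = η / 3 := by field_simp
  -- The choice `s = g p` leaves `ψ` paired only with the small vector `g (c r) - s`; each of the
  -- three terms is at most `η / 3`.
  have heq : a (c r) + inner ℝ (g (c r)) (ψ r) - deriv z r - (a p + H t₀ e s) =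
      (a (c r) - a p) + inner ℝ (g (c r) - s) (ψ r) + (H r (zeroExt x.1 r) s - H t₀ e s) := by
    rw [k2, inner_sub_left]
    ring
  rw [heq, Real.norm_eq_abs]
  refine (abs_add_le _ _).trans ?_
  linarith [abs_add_le (a (c r) - a p) (inner ℝ (g (c r) - s) (ψ r))]

end Characteristics

/-! ### Uniqueness of `ci`-derivatives. -/

section Uniqueness

variable {n : ℕ} {α T : ℝ}

/-- A constant Caputo derivative turns the `ci`-expansion into an ordinary right derivative, which
is unique; varying `v` then separates `a` from `g`. -/
theorem HasCiDerivAt.hasDerivWithinAt_of_caputoDeriv_eq {φ : GA α n T → ℝ} {p : GAo α n T} {a : ℝ}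
    {g : Vec n} (h : HasCiDerivAt φ p a g) {x : ACFun α n T} (hx : Extends x p.1.1) {v : Vec n}
    (hv : ∀ᵐ τ, τ ∈ Ioc (p.1.1.t : ℝ) T → caputoDeriv α (zeroExt x.1) τ = v) (hT : 0 ≤ T) :
    HasDerivWithinAt (fun t : ℝ => φ (restr x (projIcc 0 T hT t))) (a + inner ℝ g v)
      (Ioi (p.1.1.t : ℝ)) p.1.1.t := by
  rw [hasDerivWithinAt_iff_isLittleO]
  refine (h.isLittleO_right hx hT).congr' ?_ .rfl
  filter_upwards [Ioo_mem_nhdsGT p.2] with t ht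
  have hD : ∫ r in (p.1.1.t : ℝ)..t, inner ℝ g (caputoDeriv α (zeroExt x.1) r) =
      ∫ _ in (p.1.1.t : ℝ)..t, inner ℝ g v := by
    refine intervalIntegral.integral_congr_ae ?_
    filter_upwards [hv] with r hr hmem
    rw [uIoc_of_le ht.1.le] at hmem
    rw [hr ⟨hmem.1, hmem.2.trans ht.2.le⟩]
  rw [hD, intervalIntegral.integral_const, projIcc_val, restr_eq_of_extends hx, smul_eq_mul,
    smul_eq_mul]
  ring

/-- The `ci`-derivatives are unique. -/
theorem HasCiDerivAt.unique (hα : α ∈ Ioo (0 : ℝ) 1) {φ : GA α n T → ℝ} {p : GAo α n T}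
    {a a' : ℝ} {g g' : Vec n} (h : HasCiDerivAt φ p a g) (h' : HasCiDerivAt φ p a' g') :
    a = a' ∧ g = g' := by
  have hT : 0 ≤ T := p.1.1.t.2.1.trans p.1.1.t.2.2
  have key : ∀ v : Vec n, a + inner ℝ g v = a' + inner ℝ g' v := by
    intro v
    obtain ⟨x, hx, hv⟩ := exists_extends_caputoDeriv_eq hα p.1 v
    exact (uniqueDiffWithinAt_Ioi _).eq_deriv _
      (h.hasDerivWithinAt_of_caputoDeriv_eq hx hv hT)
      (h'.hasDerivWithinAt_of_caputoDeriv_eq hx hv hT)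
  have ha : a = a' := by simpa using key 0
  refine ⟨ha, ext_inner_right ℝ fun v => ?_⟩
  have := key v
  rw [ha] at this
  exact add_left_cancel this

end Uniqueness

end FracHJ

/-! ### Smooth minimax solutions are classical. -/

open FracHJ in
theorem mainTheorem5 (n : ℕ) (T : ℝ) (hT : 0 < T) (α : ℝ) (hα : α ∈ Set.Ioo (0 : ℝ) 1)
    (H : ℝ → Vec n → Vec n → ℝ) (σ : ACFun α n T → ℝ) (cH : ℝ) (hcH : 0 < cH)
    (hH1 : ContinuousOn (fun q : ℝ × Vec n × Vec n => H q.1 q.2.1 q.2.2)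
      (Set.Icc 0 T ×ˢ Set.univ))
    (hH2 : ∀ t ∈ Set.Icc 0 T, ∀ x s s' : Vec n,
      |H t x s - H t x s'| ≤ cH * (1 + ‖x‖) * ‖s - s'‖)
    (hH3 : ∀ R : ℝ, 0 ≤ R → ∃ lam : ℝ, 0 < lam ∧ ∀ t ∈ Set.Icc 0 T, ∀ x x' s : Vec n,
      ‖x‖ ≤ R → ‖x'‖ ≤ R → |H t x s - H t x' s| ≤ lam * (1 + ‖s‖) * ‖x - x'‖)
    (hσ : Continuous σ)
    (φ : GA α n T → ℝ) (hφ : IsMinimaxSolution hT cH H σ φ) (hsm : IsCiSmooth φ) :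
    IsClassicalSolution hT H σ φ := by
  obtain ⟨⟨_, hup, hU⟩, ⟨_, hlow, hL⟩⟩ := hφ
  refine ⟨hsm, fun p => ?_, fun w => le_antisymm (hlow w) (hup w)⟩
  obtain ⟨hφc, a, g, hd, ha, hg⟩ := hsm
  refine ⟨⟨a p, g p, hd p⟩, fun a' g' h' => ?_⟩
  obtain ⟨rfl, rfl⟩ := (hd p).unique hα h'
  set Q := a p + H p.1.1.t p.1.1.endpoint (g p) with hQ
  -- One `η` comes from the uniform estimate, the other from the tolerance `ε = η (t' - t₀)`, with
  -- `t₀` the time of `p`: `ε` may depend on `t'`, so it survives division by the time increment.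
  have key : ∀ η > 0, |Q| ≤ 2 * η := by
    intro η hη
    obtain ⟨δ, hδ, hest⟩ := exists_forall_characteristic_le hα hcH hH1 hφc hd ha hg p hη
    obtain ⟨t, ht1, ht2⟩ : ∃ t : ℝ, (p.1.1.t : ℝ) < t ∧ t ≤ min T (p.1.1.t + δ) :=
      ⟨_, lt_min p.2 (by linarith), le_rfl⟩
    set t' : Set.Icc (0 : ℝ) T := ⟨t, p.1.1.t.2.1.trans ht1.le, ht2.trans (min_le_left _ _)⟩
    have ht' : p.1.1.t < t' := ht1
    have htδ : (t' : ℝ) ≤ p.1.1.t + δ := ht2.trans (min_le_right _ _)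
    have hpos : 0 < (t' : ℝ) - p.1.1.t := sub_pos.2 ht1
    obtain ⟨x, z, hxz, hx⟩ := hU p t' ht' (g p) (η * (t' - p.1.1.t)) (mul_pos hη hpos)
    obtain ⟨y, w, hyw, hy⟩ := hL p t' ht' (g p) (η * (t' - p.1.1.t)) (mul_pos hη hpos)
    have h1 := (abs_le.1 (hest t' ht' htδ x z hxz)).1
    have h2 := (abs_le.1 (hest t' ht' htδ y w hyw)).2
    rw [abs_le]
    constructor
    · refine le_of_mul_le_mul_right ?_ hpos
      linarith
    · refine le_of_mul_le_mul_right ?_ hpos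
      linarith
  refine abs_eq_zero.1 (le_antisymm (le_of_forall_pos_le_add fun ε hε => ?_) (abs_nonneg Q))
  linarith [key (ε / 2) (by positivity)]
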